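/- All alphabets are finite. A morphism $\varphi\colon A^*\to B^*$ is a homomorphism of free monoids (it may send letters to the empty word). If $\varphi\colon A^*\to A^*$ is a morphism and $a\in A$ is a letter such that $\varphi(a)=au$ for some word $u\in A^*$ with $\varphi^k(u)$ non-empty for all $k\ge 0$, then $\varphi^\infty(a)$ denotes the right-infinite word $a\,u\,\varphi(u)\,\varphi^2(u)\,\varphi^3(u)\cdots$. A morphism $h\colon A^*\to B^*$ is applied to an infinite word letter by letter. A morphism $\rho\colon D^*\to D^*$ is primitive if for some $k\ge 1$ every letter of $D$ occurs in $\rho^k(c)$ for every letter $c\in D$. A right-infinite word $W$ is periodic if for some $k\ge 1$ one has $W[i+k]=W[i]$ for all $i$, and it is uniformly recurrent if for every finite factor $v$ of $W$ there is a number $k$ such that $v$ occurs in every factor of $W$ of length at least $k$. Lemma. Let $\varphi\colon A^*\to A^*$ and $h\colon A^*\to B^*$ be arbitrary morphisms and let $a\in A$ be a letter for which $\varphi^\infty(a)$ is defined and $W=h(\varphi^\infty(a))$ is an infinite word. If $W$ is uniformly recurrent and not periodic, then there exist a finite alphabet $D$, a primitive morphism $\rho\colon D^*\to D^*$, a morphism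 $g\colon D^*\to B^*$ and a letter $d\in D$ such that $\rho^\infty(d)$ is defined, $g(\rho^\infty(d))$ is an infinite word, and $g(\rho^\infty(d))$ and $W$ have the same set of finite factors. -/

import Mathlib

/-! Finite words over an alphabet `A` are elements of the free monoid `FreeMonoid A`, right-infinite
words are functions `ℕ → A`, and morphisms are monoid homomorphisms between free monoids
(letters may be erased). -/

namespace MorphicWords

/-- The finite word `X[i] X[i+1] … X[i+n-1]` of length `n`. -/
def block {A : Type*} (X : ℕ → A) (i n : ℕ) : List A :=
  (List.range n).map (fun j => X (i + j))

/-- The set of finite factors (subwords) of the infinite word `X`. -/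
def factors {A : Type*} (X : ℕ → A) : Set (FreeMonoid A) :=
  {v | ∃ i n : ℕ, v.toList = block X i n}

/-- Every factor `v` of `X` occurs in every sufficiently long factor of `X`. -/
def UniformlyRecurrent {A : Type*} (X : ℕ → A) : Prop :=
  ∀ v ∈ factors X, ∃ k : ℕ, ∀ u ∈ factors X, k ≤ u.toList.length → v.toList <:+: u.toList

/-- `X[i + k] = X[i]` for all `i`, for some period `k ≥ 1`. -/
def IsPeriodic {A : Type*} (X : ℕ → A) : Prop :=
  ∃ k : ℕ, 1 ≤ k ∧ Function.Periodic X k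

/-- The finite word `w 0 * w 1 * ⋯ * w (n - 1)`. -/
def partialConcat {A : Type*} (w : ℕ → FreeMonoid A) (n : ℕ) : FreeMonoid A :=
  ((List.range n).map w).prod

/-- `X` is the infinite concatenation `w 0 * w 1 * w 2 * ⋯`, which is an infinite word: all the
partial concatenations are prefixes of `X` and their lengths are unbounded. -/
def IsConcat {A : Type*} (w : ℕ → FreeMonoid A) (X : ℕ → A) : Prop :=
  (∀ n : ℕ, (partialConcat w n).toList = block X 0 (partialConcat w n).toList.length) ∧
    ∀ N : ℕ, ∃ n : ℕ, N ≤ (partialConcat w n).toList.length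

/-- `W = h(X)`: the infinite word `W` is `h(X[0]) h(X[1]) h(X[2]) ⋯`. -/
def IsImage {A B : Type*} (h : FreeMonoid A →* FreeMonoid B) (X : ℕ → A) (W : ℕ → B) : Prop :=
  IsConcat (fun i => h (FreeMonoid.of (X i))) W

/-- `X = φ^∞(a)`: one has `φ(a) = a u`, no `φ^k(u)` is the empty word, and
`X = a u φ(u) φ²(u) φ³(u) ⋯`. -/
def IsPureMorphic {A : Type*} (φ : FreeMonoid A →* FreeMonoid A) (a : A) (X : ℕ → A) : Prop :=
  ∃ u : FreeMonoid A, φ (FreeMonoid.of a) = FreeMonoid.of a * u ∧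
    (∀ k : ℕ, (⇑φ)^[k] u ≠ 1) ∧
    IsConcat (fun i => Nat.casesOn i (FreeMonoid.of a) (fun k => (⇑φ)^[k] u)) X

/-- For some power `φ^k`, `k ≥ 1`, every letter occurs in the image of every letter. -/
def IsPrimitive {A : Type*} (φ : FreeMonoid A →* FreeMonoid A) : Prop :=
  ∃ k : ℕ, 1 ≤ k ∧ ∀ b c : A, b ∈ ((⇑φ)^[k] (FreeMonoid.of c)).toList

end MorphicWords

/-! Let `L` be the set of factors of `W`; all the words `h(φ^n(a))` lie in `L`.

If `L` contains all the powers of some `v ≠ 1`, then the one-letter morphism `d ↦ dd` together with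
`d ↦ v` generates a word with factors in `L`. Assume from now on that there is no such `v`.

For a power of `φ`, once the letters whose images under `h` eventually vanish are erased, lengths
are nondecreasing along orbits. Hence every letter either has growing images or, for a further
power, an image fixed forever; such a letter is replaced by its image, a word of constants. What
remains are growing letters `s` and constants, with `ψ(s) = v_s m_s u_s`, where `v_s` and `u_s` are
words of constants and `m_s` begins and ends with a growing letter. Then `ψ = δ ∘ θ` with
`θ(s) = v_s s u_s` and `δ(s) = m_s`, and `δ` semiconjugates `θ ∘ δ` to `ψ`. For a power, the maps
sending `s` to the first and to the last letter of `m_s` are idempotent. If `s` is in the image of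
the first map, then `ψ^n(s)` begins with `v_s^n`, so `v_s` is empty, and symmetrically for `u_s`.
Therefore the images of the growing letters under `θ ∘ δ` begin and end with growing letters.

Now read a growing letter followed by a maximal word of constants as a single letter. The constants
after the last growing letter of a word are carried along unchanged by the morphism, so finitely
many such letters are enough, and all of them grow. For a power, the set of letters occurring in the
image of a letter is unchanged by further iteration; on a minimal such set the morphism is
primitive, and some power of it is prolongable on a letter. Its limit word has an infinite image
with all factors in `L`, and by uniform recurrence these are all the elements of `L`. -/

namespace MorphicWords

open FreeMonoid Function
open Filter (Tendsto atTop)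

section Iteration

theorem exists_iterate_idempotent {ι α : Type*} [Finite ι] (f : α → α) (x : ι → α)
    (hfin : ∀ i, (Set.range fun n => f^[n] (x i)).Finite) :
    ∃ p, 1 ≤ p ∧ ∀ i, f^[p] (f^[p] (x i)) = f^[p] (x i) := by
  obtain ⟨m, n, hmn, heq⟩ := Set.Finite.exists_lt_map_eq_of_forall_mem
    (f := fun n i => f^[n] (x i)) (t := {y | ∀ i, y i ∈ Set.range fun n => f^[n] (x i)})
    (fun n i => ⟨n, rfl⟩) (Set.Finite.pi' hfin)
  obtain ⟨q, rfl⟩ := Nat.exists_eq_add_of_lt hmn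
  have hperiod : ∀ k i, f^[m + (q + 1) * k] (x i) = f^[m] (x i) := by
    intro k i
    induction k with
    | zero => rfl
    | succ k ih =>
      rw [mul_add_one, ← add_assoc, add_right_comm, add_comm, iterate_add_apply, ← add_assoc,
        ← congrFun heq i, ← iterate_add_apply, add_comm, ih]
  obtain ⟨r, hr⟩ : ∃ r, (q + 1) * (m + 1) = r + m :=
    Nat.exists_eq_add_of_le' (by nlinarith)
  refine ⟨(q + 1) * (m + 1), Nat.mul_pos q.succ_pos m.succ_pos, fun i => ?_⟩
  rw [← iterate_add_apply]
  nth_rw 1 [hr]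
  rw [add_assoc, iterate_add_apply, hperiod, ← iterate_add_apply, hr]

/-- The `n`-th iterate of an endomorphism of a monoid, bundled as a homomorphism. -/
def iterateHom {M : Type*} [Monoid M] (f : M →* M) (n : ℕ) : M →* M :=
  (show Monoid.End M from f) ^ n

variable {M : Type*} [Monoid M] (f : M →* M)

theorem coe_iterateHom (n : ℕ) : ⇑(iterateHom f n) = f^[n] := rfl

theorem iterateHom_iterateHom (m n : ℕ) : iterateHom (iterateHom f m) n = iterateHom f (m * n) :=
  (pow_mul (show Monoid.End M from f) m n).symm

theorem iterateHom_comp_iterateHom (m n : ℕ) :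
    (iterateHom f m).comp (iterateHom f n) = iterateHom f (m + n) :=
  (pow_add (show Monoid.End M from f) m n).symm

end Iteration

section FreeMonoid

variable {A B D : Type*}

theorem exists_eq_mul_of_mem {c : A} {w : FreeMonoid A} (hc : c ∈ w) :
    ∃ x y, w = x * of c * y := by
  obtain ⟨x, y, hw⟩ := List.append_of_mem (show c ∈ w.toList from hc)
  exact ⟨ofList x, ofList y, hw.trans (List.append_cons x c y)⟩

theorem eq_one_iff_forall_notMem {w : FreeMonoid A} : w = 1 ↔ ∀ c, c ∉ w :=
  List.eq_nil_iff_forall_not_mem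

theorem mem_hom_iff (f : FreeMonoid A →* FreeMonoid B) {d : B} {w : FreeMonoid A} :
    d ∈ f w ↔ ∃ c ∈ w, d ∈ f (of c) := by
  induction w using FreeMonoid.inductionOn' with
  | one => simp [notMem_one]
  | of_mul c w ih => simp [mem_mul, ih, or_and_right, exists_or]

theorem hom_eq_one_iff (f : FreeMonoid A →* FreeMonoid B) {w : FreeMonoid A} :
    f w = 1 ↔ ∀ c ∈ w, f (of c) = 1 := by
  simp only [eq_one_iff_forall_notMem]
  exact ⟨fun h c hc d hd => h d ((mem_hom_iff f).2 ⟨c, hc, hd⟩), fun h d hd =>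
    let ⟨c, hc, hdc⟩ := (mem_hom_iff f).1 hd
    h c hc d hdc⟩

theorem hom_congr_of_mem {M : Type*} [Monoid M] {f g : FreeMonoid A →* M} {w : FreeMonoid A}
    (hfg : ∀ c ∈ w, f (of c) = g (of c)) : f w = g w := by
  rw [← lift_restrict f, ← lift_restrict g, lift_apply, lift_apply]
  exact congrArg List.prod (List.map_congr_left hfg)

theorem length_le_length_hom {f : FreeMonoid A →* FreeMonoid B} {w : FreeMonoid A}
    (hf : ∀ c ∈ w, f (of c) ≠ 1) : w.length ≤ (f w).length := by
  induction w using FreeMonoid.inductionOn' with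
  | one => exact Nat.zero_le _
  | of_mul c w ih =>
    have hw := ih fun d hd => hf d (mem_mul.2 (Or.inr hd))
    have hc : (f (of c)).length ≠ 0 :=
      mt length_eq_zero.1 (hf c (mem_mul.2 (Or.inl mem_of_self)))
    rw [map_mul, length_mul, length_mul, length_of]
    omega

theorem semiconj_of_forall_of {φ : FreeMonoid A →* FreeMonoid A} {M : Type*} [Monoid M]
    {ψ : M →* M} {τ : FreeMonoid A →* M} (h : ∀ c, τ (φ (of c)) = ψ (τ (of c))) :
    Semiconj τ φ ψ :=
  DFunLike.congr_fun (hom_eq (f := τ.comp φ) (g := ψ.comp τ) h)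

theorem exists_hom_semiconj_map {φ : FreeMonoid A →* FreeMonoid A} {i : D → A}
    (hi : ∀ d, ∀ c ∈ φ (of (i d)), c ∈ Set.range i) :
    ∃ ρ : FreeMonoid D →* FreeMonoid D, Semiconj (map i) ρ φ := by
  have hlift : ∀ d, ∃ v, map i v = φ (of (i d)) := fun d => by
    obtain ⟨v, hv⟩ : (φ (of (i d))).toList ∈ Set.range (List.map i) := by
      rw [Set.range_list_map]
      exact hi d
    exact ⟨ofList v, hv⟩
  choose r hr using hlift
  exact ⟨lift r, semiconj_of_forall_of hr⟩

theorem head?_hom {φ : FreeMonoid A →* FreeMonoid A} {f : A → A}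
    (hf : ∀ c, (φ (of c)).toList.head? = some (f c)) (w : FreeMonoid A) :
    (φ w).toList.head? = w.toList.head?.map f := by
  cases w with
  | one => simp
  | of_mul c w => simp [hf]

theorem getLast?_hom {φ : FreeMonoid A →* FreeMonoid A} {f : A → A}
    (hf : ∀ c, (φ (of c)).toList.getLast? = some (f c)) (w : FreeMonoid A) :
    (φ w).toList.getLast? = w.toList.getLast?.map f := by
  induction w using FreeMonoid.inductionOn' with
  | one => simp
  | of_mul c w ih =>
    rw [map_mul, toList_mul, toList_mul, List.getLast?_append, List.getLast?_append, ih, hf]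
    cases w.toList.getLast? <;> rfl

theorem head?_iterate_of {φ : FreeMonoid A →* FreeMonoid A} {f : A → A}
    (hf : ∀ c, (φ (of c)).toList.head? = some (f c)) (n : ℕ) (c : A) :
    (φ^[n] (of c)).toList.head? = some (f^[n] c) := by
  induction n with
  | zero => rfl
  | succ n ih => rw [iterate_succ_apply', head?_hom hf, ih, iterate_succ_apply', Option.map_some]

theorem getLast?_iterate_of {φ : FreeMonoid A →* FreeMonoid A} {f : A → A}
    (hf : ∀ c, (φ (of c)).toList.getLast? = some (f c)) (n : ℕ) (c : A) :
    (φ^[n] (of c)).toList.getLast? = some (f^[n] c) := by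
  induction n with
  | zero => rfl
  | succ n ih => rw [iterate_succ_apply', getLast?_hom hf, ih, iterate_succ_apply', Option.map_some]

theorem exists_head?_eq_some {w : FreeMonoid A} (hw : w ≠ 1) : ∃ c, w.toList.head? = some c :=
  ⟨_, List.head?_eq_some_head hw⟩

theorem exists_getLast?_eq_some {w : FreeMonoid A} (hw : w ≠ 1) :
    ∃ c, w.toList.getLast? = some c :=
  ⟨_, List.getLast?_eq_some_getLast hw⟩

theorem head?_eq_some_iff_exists_of_mul {w : FreeMonoid A} {c : A} :
    w.toList.head? = some c ↔ ∃ x, w = of c * x :=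
  List.head?_eq_some_iff

theorem getLast?_eq_some_iff_exists_mul_of {w : FreeMonoid A} {c : A} :
    w.toList.getLast? = some c ↔ ∃ x, w = x * of c :=
  List.getLast?_eq_some_iff

/-- The morphism deleting all the letters that lie in `s`. -/
noncomputable def eraseLetters (s : Set A) : FreeMonoid A →* FreeMonoid A :=
  open Classical in lift fun c => if c ∈ s then 1 else of c

theorem mem_eraseLetters {s : Set A} {w : FreeMonoid A} {d : A} :
    d ∈ eraseLetters s w ↔ d ∈ w ∧ d ∉ s := by
  classical
  have hof : ∀ c, d ∈ eraseLetters s (of c) ↔ d = c ∧ d ∉ s := fun c => by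
    rw [eraseLetters, lift_eval_of]
    split_ifs with hc
    · simpa [notMem_one] using fun hdc : d = c => hdc ▸ hc
    · simpa [mem_of] using fun hdc : d = c => hdc ▸ hc
  rw [mem_hom_iff]
  simp [hof]

theorem hom_eraseLetters {M : Type*} [Monoid M] {s : Set A} {f : FreeMonoid A →* M}
    (hf : ∀ c ∈ s, f (of c) = 1) (w : FreeMonoid A) : f (eraseLetters s w) = f w := by
  refine DFunLike.congr_fun (hom_eq (f := f.comp (eraseLetters s)) fun c => ?_) w
  rw [MonoidHom.comp_apply, eraseLetters, lift_eval_of]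
  split_ifs with hc
  · rw [map_one, hf c hc]
  · rfl

end FreeMonoid

section Dynamics

/-- A set of words containing, with each word, all of its factors. -/
def FactorClosed {B : Type*} (L : Set (FreeMonoid B)) : Prop :=
  ∀ ⦃x y z⦄, x * y * z ∈ L → y ∈ L

/-- The only word all of whose powers lie in `L` is the empty word. -/
def OmegaPowerFree {B : Type*} (L : Set (FreeMonoid B)) : Prop :=
  ∀ v, (∀ n : ℕ, v ^ n ∈ L) → v = 1

/-- The `h`-images of all the words in the `φ`-orbit of `w` lie in `L`. -/
def StaysIn {A B : Type*} (L : Set (FreeMonoid B)) (φ : FreeMonoid A →* FreeMonoid A)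
    (h : FreeMonoid A →* FreeMonoid B) (w : FreeMonoid A) : Prop :=
  ∀ n, h (φ^[n] w) ∈ L

/-- The `h`-images of the words in the `φ`-orbit of `w` get arbitrarily long. Asking for a limit
rather than for unboundedness makes the notion stable under passing to a power of `φ`. -/
def Grows {A B : Type*} (φ : FreeMonoid A →* FreeMonoid A) (h : FreeMonoid A →* FreeMonoid B)
    (w : FreeMonoid A) : Prop :=
  Tendsto (fun n => (h (φ^[n] w)).length) atTop atTop

variable {A B : Type*} {L : Set (FreeMonoid B)} {φ : FreeMonoid A →* FreeMonoid A}
  {h : FreeMonoid A →* FreeMonoid B} {w x y z : FreeMonoid A}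

theorem StaysIn.factor (hs : StaysIn L φ h (x * y * z)) (hL : FactorClosed L) :
    StaysIn L φ h y := fun n =>
  hL (by simpa only [iterate_map_mul, map_mul] using hs n)

theorem StaysIn.of_mem {c : A} (hs : StaysIn L φ h w) (hL : FactorClosed L) (hc : c ∈ w) :
    StaysIn L φ h (of c) := by
  obtain ⟨x, y, rfl⟩ := exists_eq_mul_of_mem hc
  exact hs.factor hL

theorem StaysIn.iterateHom_comp (hs : StaysIn L φ h w) (p q : ℕ) :
    StaysIn L (iterateHom φ p) (h.comp (iterateHom φ q)) w := fun n => by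
  simpa only [MonoidHom.comp_apply, coe_iterateHom, ← iterate_mul, ← iterate_add_apply]
    using hs (q + p * n)

theorem StaysIn.map_self (hs : StaysIn L φ h w) : StaysIn L φ h (φ w) := fun n =>
  hs (n + 1)

theorem Grows.factor (hy : Grows φ h y) : Grows φ h (x * y * z) :=
  Filter.tendsto_atTop_mono (fun n => by
    simp only [iterate_map_mul, map_mul, length_mul]
    omega) hy

theorem Grows.of_mem {c : A} (hg : Grows φ h (of c)) (hc : c ∈ w) : Grows φ h w := by
  obtain ⟨x, y, rfl⟩ := exists_eq_mul_of_mem hc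
  exact hg.factor

theorem Grows.iterateHom_comp (hg : Grows φ h w) {p : ℕ} (hp : 1 ≤ p) (q : ℕ) :
    Grows (iterateHom φ p) (h.comp (iterateHom φ q)) w := by
  have hlim : Tendsto (fun n => q + p * n) atTop atTop :=
    Filter.tendsto_atTop_mono (fun n => show n ≤ q + p * n by nlinarith) Filter.tendsto_id
  refine (hg.comp hlim).congr fun n => ?_
  simp only [comp_apply, MonoidHom.comp_apply, coe_iterateHom, ← iterate_mul, ← iterate_add_apply]

theorem Grows.ne_one (hg : Grows φ h w) : w ≠ 1 := by
  rintro rfl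
  obtain ⟨n, hn⟩ := (hg.eventually_gt_atTop 0).exists
  simp [iterate_map_one] at hn

theorem grows_map_self_iff : Grows φ h (φ w) ↔ Grows φ h w :=
  Filter.tendsto_add_atTop_iff_nat (f := fun n => (h (φ^[n] w)).length) 1

variable {D : Type*} {ψ : FreeMonoid D →* FreeMonoid D} {k : FreeMonoid D →* FreeMonoid B}
  {τ : FreeMonoid A →* FreeMonoid D}

theorem staysIn_map_iff (hτ : Semiconj τ φ ψ) :
    StaysIn L ψ k (τ w) ↔ StaysIn L φ (k.comp τ) w :=
  forall_congr' fun n => by rw [MonoidHom.comp_apply, (hτ.iterate_right n).eq]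

theorem grows_map_iff (hτ : Semiconj τ φ ψ) : Grows ψ k (τ w) ↔ Grows φ (k.comp τ) w :=
  Filter.tendsto_congr fun n => by rw [MonoidHom.comp_apply, (hτ.iterate_right n).eq]

end Dynamics

section Dichotomy

variable {A B : Type*} [Finite A]

theorem exists_iterate_mem_idempotent (φ : FreeMonoid A →* FreeMonoid A) :
    ∃ p, 1 ≤ p ∧ ∀ c d, d ∈ φ^[p] (φ^[p] (of c)) ↔ d ∈ φ^[p] (of c) := by
  let letters : FreeMonoid A → Set A := fun w => {d | d ∈ w}
  let step : Set A → Set A := fun s => {d | ∃ c ∈ s, d ∈ φ (of c)}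
  have hsemi : Semiconj letters φ step := fun w => Set.ext fun d => mem_hom_iff φ
  obtain ⟨p, hp, hidem⟩ := exists_iterate_idempotent step (fun c => letters (of c))
    fun _ => Set.toFinite _
  have hletters : ∀ c, letters (φ^[p] (φ^[p] (of c))) = letters (φ^[p] (of c)) := fun c => by
    rw [hsemi.iterate_right p, hsemi.iterate_right p, hidem]
  exact ⟨p, hp, fun c => Set.ext_iff.1 (hletters c)⟩

theorem tendsto_length_iterate_or_finite_range {θ : FreeMonoid A →* FreeMonoid A}
    {w : FreeMonoid A} (hθ : ∀ n, ∀ c ∈ θ^[n] w, θ (of c) ≠ 1) :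
    Tendsto (fun n => (θ^[n] w).length) atTop atTop ∨ (Set.range fun n => θ^[n] w).Finite := by
  have hmono : Monotone fun n => (θ^[n] w).length := monotone_nat_of_le_succ fun n => by
    rw [iterate_succ_apply']
    exact length_le_length_hom (hθ n)
  by_cases hbdd : ∃ N, ∀ n, (θ^[n] w).length ≤ N
  · obtain ⟨N, hN⟩ := hbdd
    exact Or.inr ((List.finite_length_le A N).subset (Set.range_subset_iff.2 hN))
  · push Not at hbdd
    exact Or.inl (Filter.tendsto_atTop_atTop_of_monotone hmono fun N =>
      (hbdd N).imp fun _ => le_of_lt)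

theorem exists_grows_or_iterate_idempotent {ψ : FreeMonoid A →* FreeMonoid A}
    {k : FreeMonoid A →* FreeMonoid B} (hk : ∀ c, k (ψ (of c)) = 1 ↔ k (of c) = 1) :
    ∃ q, 1 ≤ q ∧ ∀ c, Grows ψ k (of c) ∨ k (ψ^[q] (ψ^[q] (of c))) = k (ψ^[q] (of c)) := by
  set s : Set A := {c | k (of c) = 1}
  set δ := eraseLetters s
  have hkδ : ∀ w, k (δ w) = k w := hom_eraseLetters fun c hc => hc
  have hsemi : Semiconj δ ψ (δ.comp ψ) := fun w => by
    refine (hom_eraseLetters (f := δ.comp ψ) (fun c hc => ?_) w).symm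
    refine eq_one_iff_forall_notMem.2 fun d hd => ?_
    obtain ⟨hd, hds⟩ := mem_eraseLetters.1 hd
    exact hds ((hom_eq_one_iff k).1 ((hk c).2 hc) d hd)
  have horbit : ∀ n w, δ (ψ^[n] w) = (δ.comp ψ)^[n] (δ w) := fun n => hsemi.iterate_right n
  have hmem : ∀ n w, ∀ c ∈ (δ.comp ψ)^[n] (δ w), k (of c) ≠ 1 := fun n w c hc => by
    rw [← horbit] at hc
    exact (mem_eraseLetters.1 hc).2
  have hne : ∀ c, k (of c) ≠ 1 → δ.comp ψ (of c) ≠ 1 := fun c hc h => by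
    rw [Ne, ← hk, ← hkδ] at hc
    exact hc ((congrArg k h).trans (map_one k))
  let F : Set A := {c | (Set.range fun n => (δ.comp ψ)^[n] (δ (of c))).Finite}
  obtain ⟨q, hq, hidem⟩ := exists_iterate_idempotent (δ.comp ψ) (fun c : F => δ (of c))
    fun c => c.2
  refine ⟨q, hq, fun c => ?_⟩
  rcases tendsto_length_iterate_or_finite_range fun n d hd =>
    hne d (hmem n (of c) d hd) with hc | hc
  · refine Or.inl (Filter.tendsto_atTop_mono (fun n => ?_) hc)
    rw [← hkδ (ψ^[n] _), horbit]
    exact length_le_length_hom (hmem n _)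
  · right
    rw [← hkδ (ψ^[q] _), ← hkδ (ψ^[q] (of c)), horbit, horbit]
    exact congrArg k (hidem ⟨c, hc⟩)

theorem exists_iterateHom_grows_or_fixed (φ : FreeMonoid A →* FreeMonoid A)
    (h : FreeMonoid A →* FreeMonoid B) :
    ∃ p q, 1 ≤ p ∧ ∀ c, Grows (iterateHom φ p) (h.comp (iterateHom φ q)) (of c) ∨
      h.comp (iterateHom φ q) (iterateHom φ p (of c)) = h.comp (iterateHom φ q) (of c) := by
  obtain ⟨p, hp, hmem⟩ := exists_iterate_mem_idempotent φ
  obtain ⟨q, hq, hgrows⟩ := exists_grows_or_iterate_idempotent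
    (ψ := iterateHom φ p) (k := h.comp (iterateHom φ p)) fun c => by
      rw [MonoidHom.comp_apply, MonoidHom.comp_apply, hom_eq_one_iff h, hom_eq_one_iff h]
      exact forall_congr' fun d => imp_congr_left (hmem c d)
  refine ⟨p * q, p + p * q, Nat.mul_pos hp hq, fun c => (hgrows c).imp (fun hc => ?_) fun hc => ?_⟩
  · simpa only [iterateHom_iterateHom, MonoidHom.comp_assoc, iterateHom_comp_iterateHom]
      using hc.iterateHom_comp hq q
  · simpa only [MonoidHom.comp_apply, coe_iterateHom, iterate_add_apply, iterate_mul] using hc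

end Dichotomy

section Primitive

variable {A B : Type*} {φ : FreeMonoid A →* FreeMonoid A}

theorem iterate_ne_one (hφ : ∀ c, φ (of c) ≠ 1) {w : FreeMonoid A} (hw : w ≠ 1) (n : ℕ) :
    φ^[n] w ≠ 1 := by
  induction n with
  | zero => exact hw
  | succ n ih =>
    rw [iterate_succ_apply', Ne, hom_eq_one_iff]
    exact fun h => ih (eq_one_iff_forall_notMem.2 fun c hc => hφ c (h c hc))

theorem mem_iterate_of_forall_mem (hφ : ∀ c d, d ∈ φ (of c)) {n : ℕ} (hn : 1 ≤ n) (c d : A) :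
    d ∈ φ^[n] (of c) := by
  induction n, hn using Nat.le_induction generalizing d with
  | base => exact hφ c d
  | succ n _ ih =>
    rw [iterate_succ_apply', mem_hom_iff]
    exact ⟨c, ih c, hφ c d⟩

theorem exists_restriction_forall_mem [Finite A] [Nonempty A] (hφ : ∀ c, φ (of c) ≠ 1) :
    ∃ (n : ℕ) (i : Fin n → A) (p : ℕ) (ρ : FreeMonoid (Fin n) →* FreeMonoid (Fin n)),
      Nonempty (Fin n) ∧ 1 ≤ p ∧ Semiconj (map i) ρ (iterateHom φ p) ∧ ∀ c d, d ∈ ρ (of c) := by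
  obtain ⟨p, hp, hmem⟩ := exists_iterate_mem_idempotent φ
  let S : A → Set A := fun c => {d | d ∈ iterateHom φ p (of c)}
  have hSsub : ∀ {c d}, d ∈ S c → S d ⊆ S c := fun {c d} hd e he =>
    (hmem c e).1 ((mem_hom_iff (iterateHom φ p)).2 ⟨d, hd, he⟩)
  obtain ⟨c₀, hc₀⟩ := Finite.exists_min fun c => (S c).ncard
  have hSeq : ∀ c ∈ S c₀, S c = S c₀ := fun c hc =>
    Set.eq_of_subset_of_ncard_le (hSsub hc) (hc₀ c)
  obtain ⟨n, i, hi, hrange⟩ := (Set.toFinite (S c₀)).fin_param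
  have hletters : ∀ d c, c ∈ iterateHom φ p (of (i d)) ↔ c ∈ Set.range i := fun d c => by
    rw [hrange, ← hSeq (i d) (hrange ▸ Set.mem_range_self d)]
    rfl
  obtain ⟨ρ, hρ⟩ := exists_hom_semiconj_map fun d c => (hletters d c).1
  refine ⟨n, i, p, ρ, ?_, hp, hρ, fun c d => ?_⟩
  · have hne := iterate_ne_one hφ (of_ne_one c₀) p
    obtain ⟨c, hc⟩ := not_forall_not.1 (mt eq_one_iff_forall_notMem.2 hne)
    obtain ⟨d, -⟩ : c ∈ Set.range i := hrange ▸ hc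
    exact ⟨d⟩
  · have hd : i d ∈ map i (ρ (of c)) := by
      rw [hρ, map_of, hletters]
      exact Set.mem_range_self d
    obtain ⟨e, he, hed⟩ := mem_map.1 hd
    exact hi hed ▸ he

theorem exists_iterate_prolongable [Finite A] [Nonempty A] (hφ : ∀ c, φ (of c) ≠ 1) :
    ∃ p d u, 1 ≤ p ∧ φ^[p] (of d) = of d * u := by
  choose f hf using fun c => exists_head?_eq_some (hφ c)
  obtain ⟨p, hp, hidem⟩ := exists_iterate_idempotent f id fun _ => Set.toFinite _
  obtain ⟨c⟩ := ‹Nonempty A›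
  obtain ⟨u, hu⟩ := head?_eq_some_iff_exists_of_mul.1 (head?_iterate_of hf p (f^[p] c))
  exact ⟨p, f^[p] c, u, hp, by rw [hu, show f^[p] (f^[p] c) = f^[p] c from hidem c]⟩

/-- Some word `ρ^∞(d)` generated by a primitive morphism `ρ` has an infinite image `g(ρ^∞(d))` with
all its factors in `L`. The infinite words are encoded by their prefixes `ρ^n(d)` and `g(ρ^n(d))`,
which is equivalent when `L` is closed under factors. -/
def HasPrimitiveGenerator (L : Set (FreeMonoid B)) : Prop :=
  ∃ (D : Type) (_ : Finite D) (ρ : FreeMonoid D →* FreeMonoid D) (g : FreeMonoid D →* FreeMonoid B)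
    (d : D) (u : FreeMonoid D), IsPrimitive ρ ∧ ρ (of d) = of d * u ∧ StaysIn L ρ g (of d) ∧
      Grows ρ g (of d)

variable {L : Set (FreeMonoid B)}

theorem hasPrimitiveGenerator_of_forall_grows [Finite A] [Nonempty A]
    {h : FreeMonoid A →* FreeMonoid B} (hs : ∀ c, StaysIn L φ h (of c))
    (hg : ∀ c, Grows φ h (of c)) : HasPrimitiveGenerator L := by
  obtain ⟨n, i, p, ρ, _, hp, hsemi, hmem⟩ :=
    exists_restriction_forall_mem fun c => (grows_map_self_iff.2 (hg c)).ne_one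
  obtain ⟨q, d, u, hq, hu⟩ :=
    exists_iterate_prolongable fun c hc => eq_one_iff_forall_notMem.1 hc c (hmem c c)
  have hsd : StaysIn L ρ (h.comp (map i)) (of d) :=
    (staysIn_map_iff hsemi).1 ((hs (i d)).iterateHom_comp p 0)
  have hgd : Grows ρ (h.comp (map i)) (of d) :=
    (grows_map_iff hsemi).1 ((hg (i d)).iterateHom_comp hp 0)
  exact ⟨Fin n, inferInstance, iterateHom ρ q, h.comp (map i), d, u,
    ⟨1, le_rfl, fun c e => mem_iterate_of_forall_mem hmem hq e c⟩, hu, hsd.iterateHom_comp q 0,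
    hgd.iterateHom_comp hq 0⟩

theorem hasPrimitiveGenerator_of_finite_set {h : FreeMonoid A →* FreeMonoid B}
    {E : Set A} (hE : E.Finite) (hne : E.Nonempty)
    (hφ : ∀ c ∈ E, ∀ d ∈ φ (of c), d ∈ E) (hs : ∀ c ∈ E, StaysIn L φ h (of c))
    (hg : ∀ c ∈ E, Grows φ h (of c)) : HasPrimitiveGenerator L := by
  obtain ⟨ρ, hρ⟩ := exists_hom_semiconj_map (i := ((↑) : E → A)) fun c d hd =>
    ⟨⟨d, hφ c c.2 d hd⟩, rfl⟩
  have := hE.to_subtype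
  have := hne.to_subtype
  exact hasPrimitiveGenerator_of_forall_grows (φ := ρ) (h := h.comp (map (↑)))
    (fun c => (staysIn_map_iff hρ).1 (hs c c.2)) fun c => (grows_map_iff hρ).1 (hg c c.2)

theorem le_length_pow {v : FreeMonoid B} (hv : v ≠ 1) (n : ℕ) : n ≤ (v ^ n).length := by
  induction n with
  | zero => exact Nat.zero_le _
  | succ n ih =>
    have hpos : v.length ≠ 0 := mt length_eq_zero.1 hv
    rw [pow_succ, length_mul]
    omega

theorem hasPrimitiveGenerator_of_pow_mem {v : FreeMonoid B} (hv : v ≠ 1)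
    (hL : ∀ n : ℕ, v ^ n ∈ L) : HasPrimitiveGenerator L := by
  let ρ : FreeMonoid Unit →* FreeMonoid Unit := lift fun _ => of () ^ 2
  let g : FreeMonoid Unit →* FreeMonoid B := lift fun _ => v
  have hρ : ∀ n, ρ^[n] (of ()) = of () ^ 2 ^ n := fun n => by
    induction n with
    | zero => rw [pow_zero, pow_one, iterate_zero_apply]
    | succ n ih => rw [iterate_succ_apply', ih, map_pow, lift_eval_of, ← pow_mul, ← pow_succ']
  have hg : ∀ n, g (ρ^[n] (of ())) = v ^ 2 ^ n := fun n => by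
    rw [hρ, map_pow, lift_eval_of]
  refine ⟨Unit, inferInstance, ρ, g, (), of (), ⟨1, le_rfl, fun _ _ => ?_⟩, ?_, fun n => ?_, ?_⟩
  · exact mem_mul.2 (Or.inl mem_of_self)
  · rw [lift_eval_of, sq]
  · exact hg n ▸ hL _
  · refine Filter.tendsto_atTop_mono (fun n => ?_) Filter.tendsto_id
    rw [hg]
    exact n.lt_two_pow_self.le.trans (le_length_pow hv _)

end Primitive

section GrowingLetters

/-- The morphism that takes the value `m s` at a growing letter `s : G` and agrees with `j` on the
words over the alphabet `B` of constants. -/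
def sumLift {G B M : Type*} [Monoid M] (m : G → M) (j : FreeMonoid B →* M) :
    FreeMonoid (G ⊕ B) →* M :=
  lift (Sum.elim m fun b => j (of b))

theorem sumLift_inl {G B M : Type*} [Monoid M] (m : G → M) (j : FreeMonoid B →* M) (s : G) :
    sumLift m j (of (Sum.inl s)) = m s := rfl

theorem sumLift_map_inr {G B M : Type*} [Monoid M] (m : G → M) (j : FreeMonoid B →* M)
    (v : FreeMonoid B) : sumLift m j (map Sum.inr v) = j v :=
  DFunLike.congr_fun (hom_eq (f := (sumLift m j).comp (map Sum.inr)) (g := j) fun _ => rfl) v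

/-- `ψ` and `h` fix the constants, that is, the letters in `B`, whereas the letters in `G` grow with
all their images in `L`. -/
structure IsGrowingOver {G B : Type*} (L : Set (FreeMonoid B))
    (ψ : FreeMonoid (G ⊕ B) →* FreeMonoid (G ⊕ B)) (h : FreeMonoid (G ⊕ B) →* FreeMonoid B) :
    Prop where
  map_inr : ∀ v, ψ (map Sum.inr v) = map Sum.inr v
  hom_inr : ∀ v, h (map Sum.inr v) = v
  staysIn : ∀ s, StaysIn L ψ h (of (Sum.inl s))
  grows : ∀ s, Grows ψ h (of (Sum.inl s))

theorem exists_isGrowingOver {A B : Type*} {L : Set (FreeMonoid B)}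
    {φ : FreeMonoid A →* FreeMonoid A} {h : FreeMonoid A →* FreeMonoid B}
    (hs : ∀ c, StaysIn L φ h (of c))
    (hφ : ∀ c, Grows φ h (of c) ∨ h (φ (of c)) = h (of c)) :
    ∃ (ψ : FreeMonoid ({c // Grows φ h (of c)} ⊕ B) →* _) (k : _ →* FreeMonoid B),
      IsGrowingOver L ψ k := by
  classical
  let τ : FreeMonoid A →* FreeMonoid ({c // Grows φ h (of c)} ⊕ B) := lift fun c =>
    if hc : Grows φ h (of c) then of (Sum.inl ⟨c, hc⟩) else map Sum.inr (h (of c))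
  have hτ_grows : ∀ c (hc : Grows φ h (of c)), τ (of c) = of (Sum.inl ⟨c, hc⟩) := fun c hc => by
    rw [lift_eval_of, dif_pos hc]
  have hτ_const : ∀ w, ¬ Grows φ h w → τ w = map Sum.inr (h w) := fun w hw => by
    refine hom_congr_of_mem (g := (map Sum.inr).comp h) fun c hc => ?_
    rw [lift_eval_of, dif_neg (mt (fun hg => hg.of_mem hc) hw)]
    rfl
  let ψ := sumLift (fun s : {c // Grows φ h (of c)} => τ (φ (of s.1))) (map Sum.inr)
  let k := sumLift (fun s : {c // Grows φ h (of c)} => h (of s.1)) (.id _)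
  have hsemi : Semiconj τ φ ψ := semiconj_of_forall_of fun c => by
    by_cases hc : Grows φ h (of c)
    · rw [hτ_grows c hc, sumLift_inl]
    · rw [hτ_const _ hc, sumLift_map_inr, hτ_const _ (mt grows_map_self_iff.1 hc),
        (hφ c).resolve_left hc]
  have hk : k.comp τ = h := hom_eq fun c => by
    by_cases hc : Grows φ h (of c)
    · rw [MonoidHom.comp_apply, hτ_grows c hc, sumLift_inl]
    · rw [MonoidHom.comp_apply, hτ_const _ hc, sumLift_map_inr, MonoidHom.id_apply]
  refine ⟨ψ, k, fun v => sumLift_map_inr _ _ v, fun v => sumLift_map_inr _ _ v, fun s => ?_,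
    fun s => ?_⟩
  · rw [← hτ_grows, staysIn_map_iff hsemi, hk]
    exact hs s
  · rw [← hτ_grows, grows_map_iff hsemi, hk]
    exact s.2

end GrowingLetters

section Trimming

theorem exists_iterate_eq_pow_mul {M : Type*} [Monoid M] {f : M →* M} {v c x : M} (hv : f v = v)
    (hc : f c = v * c * x) (n : ℕ) : ∃ y, f^[n] c = v ^ n * y := by
  suffices h : ∃ y, f^[n] c = v ^ n * c * y from h.imp' (c * ·) fun y hy => by rw [hy, mul_assoc]
  induction n with
  | zero => exact ⟨1, by simp⟩
  | succ n ih =>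
    obtain ⟨y, hy⟩ := ih
    exact ⟨x * f y, by rw [iterate_succ_apply', hy, map_mul, map_mul, map_pow, hv, hc, pow_succ]
                       simp only [mul_assoc]⟩

theorem exists_iterate_eq_mul_pow {M : Type*} [Monoid M] {f : M →* M} {v c x : M} (hv : f v = v)
    (hc : f c = x * c * v) (n : ℕ) : ∃ y, f^[n] c = y * v ^ n := by
  suffices h : ∃ y, f^[n] c = y * c * v ^ n from h.imp' (· * c) fun y hy => hy
  induction n with
  | zero => exact ⟨1, by simp⟩
  | succ n ih =>
    obtain ⟨y, hy⟩ := ih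
    exact ⟨f y * x, by rw [iterate_succ_apply', hy, map_mul, map_mul, map_pow, hv, hc, pow_succ']
                       simp only [mul_assoc]⟩

variable {G B : Type*} {L : Set (FreeMonoid B)} {ψ : FreeMonoid (G ⊕ B) →* FreeMonoid (G ⊕ B)}
  {h : FreeMonoid (G ⊕ B) →* FreeMonoid B}

/-- The morphism deleting the constants. -/
def growingPart : FreeMonoid (G ⊕ B) →* FreeMonoid G := sumLift of 1

theorem growingPart_map_inr (v : FreeMonoid B) :
    growingPart (map (Sum.inr : B → G ⊕ B) v) = 1 :=
  sumLift_map_inr of 1 v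

theorem exists_eq_map_inr_of_growingPart_eq_one {w : FreeMonoid (G ⊕ B)}
    (hw : growingPart w = 1) : ∃ v, w = map Sum.inr v := by
  induction w using FreeMonoid.inductionOn' with
  | one => exact ⟨1, rfl⟩
  | of_mul c w ih =>
    rw [map_mul] at hw
    rcases c with s | b
    · nomatch hw
    · rw [← map_of, growingPart_map_inr, one_mul] at hw
      obtain ⟨v, rfl⟩ := ih hw
      exact ⟨of b * v, rfl⟩

theorem eq_map_inr_or_exists_eq_mul (w : FreeMonoid (G ⊕ B)) :
    (∃ v, w = map Sum.inr v) ∨ ∃ v m u s t x y, w = map Sum.inr v * m * map Sum.inr u ∧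
      m = of (Sum.inl s) * x ∧ m = y * of (Sum.inl t) := by
  induction w using FreeMonoid.inductionOn' with
  | one => exact Or.inl ⟨1, rfl⟩
  | of_mul c w ih =>
    rcases ih with ⟨v, rfl⟩ | ⟨v, m, u, s, t, x, y, rfl, hx, hy⟩ <;> rcases c with r | b
    · exact Or.inr ⟨1, of (Sum.inl r), v, r, r, 1, 1, by rw [map_one, one_mul], by rw [mul_one],
        by rw [one_mul]⟩
    · exact Or.inl ⟨of b * v, rfl⟩
    · refine Or.inr ⟨1, of (Sum.inl r) * map Sum.inr v * m, u, r, t, _, _ * y, ?_,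
        mul_assoc _ _ _, by rw [mul_assoc _ y, ← hy]⟩
      simp only [map_one, one_mul, mul_assoc]
    · refine Or.inr ⟨of b * v, m, u, s, t, x, y, ?_, hx, hy⟩
      simp only [map_mul, map_of, mul_assoc]

theorem exists_eq_map_inr_mul_mul_map_inr {w : FreeMonoid (G ⊕ B)} {s t : G}
    (hs : (growingPart w).toList.head? = some s) (ht : (growingPart w).toList.getLast? = some t) :
    ∃ v m u x y, w = map Sum.inr v * m * map Sum.inr u ∧ m = of (Sum.inl s) * x ∧
      m = y * of (Sum.inl t) := by
  rcases eq_map_inr_or_exists_eq_mul w with ⟨v, rfl⟩ | ⟨v, m, u, s', t', x, y, rfl, hx, hy⟩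
  · rw [growingPart_map_inr] at hs
    nomatch hs
  · have hm : growingPart (map Sum.inr v * m * map Sum.inr u) = growingPart m := by
      rw [map_mul, map_mul, growingPart_map_inr, growingPart_map_inr, one_mul, mul_one]
    rw [hm, hx, map_mul, growingPart, sumLift_inl] at hs
    rw [hm, hy, map_mul, growingPart, sumLift_inl] at ht
    obtain rfl : s' = s :=
      Option.some.inj ((head?_eq_some_iff_exists_of_mul.2 ⟨_, rfl⟩).symm.trans hs)
    obtain rfl : t' = t :=
      Option.some.inj ((getLast?_eq_some_iff_exists_mul_of.2 ⟨_, rfl⟩).symm.trans ht)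
    exact ⟨v, m, u, x, y, rfl, hx, hy⟩

namespace IsGrowingOver

theorem iterateHom (hψ : IsGrowingOver L ψ h) {p : ℕ} (hp : 1 ≤ p) :
    IsGrowingOver L (iterateHom ψ p) h where
  map_inr v := iterate_fixed (hψ.map_inr v) p
  hom_inr := hψ.hom_inr
  staysIn s := (hψ.staysIn s).iterateHom_comp p 0
  grows s := (hψ.grows s).iterateHom_comp hp 0

theorem not_grows_map_inr (hψ : IsGrowingOver L ψ h) (v : FreeMonoid B) :
    ¬ Grows ψ h (map Sum.inr v) := fun hg => by
  obtain ⟨n, hn⟩ := (hg.eventually_gt_atTop v.length).exists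
  rw [iterate_fixed (hψ.map_inr v), hψ.hom_inr] at hn
  exact hn.false

theorem conj_sumLift (hψ : IsGrowingOver L ψ h) (hL : FactorClosed L) {v u : G → FreeMonoid B}
    {m : G → FreeMonoid (G ⊕ B)}
    (hm : ∀ s, ψ (of (Sum.inl s)) = map Sum.inr (v s) * m s * map Sum.inr (u s))
    (hmem : ∀ s, ∃ t, Sum.inl t ∈ m s) :
    IsGrowingOver L
      ((sumLift (fun s => map Sum.inr (v s) * of (Sum.inl s) * map Sum.inr (u s))
        (map Sum.inr)).comp (sumLift m (map Sum.inr)))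
      (h.comp (sumLift m (map Sum.inr))) := by
  set θ := sumLift (fun s => map Sum.inr (v s) * of (Sum.inl s) * map Sum.inr (u s)) (map Sum.inr)
  set D := sumLift m (map Sum.inr)
  have hθ : ∀ v, θ (map Sum.inr v) = map Sum.inr v := sumLift_map_inr _ _
  have hD : ∀ v, D (map Sum.inr v) = map Sum.inr v := sumLift_map_inr _ _
  have hfactor : D.comp θ = ψ := hom_eq fun c => by
    rcases c with s | b
    · rw [hm, MonoidHom.comp_apply, sumLift_inl, map_mul, map_mul, hD, hD, sumLift_inl]
    · rw [← map_of, hψ.map_inr, MonoidHom.comp_apply, hθ, hD]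
  have hsemi : Semiconj D (θ.comp D) ψ := hfactor ▸ fun w => rfl
  refine ⟨fun v => ?_, fun v => ?_, fun s => ?_, fun s => ?_⟩
  · rw [MonoidHom.comp_apply, hD, hθ]
  · rw [MonoidHom.comp_apply, hD, hψ.hom_inr]
  · rw [← staysIn_map_iff hsemi, sumLift_inl]
    exact (hm s ▸ (hψ.staysIn s).map_self).factor hL
  · obtain ⟨t, ht⟩ := hmem s
    rw [← grows_map_iff hsemi, sumLift_inl]
    exact (hψ.grows t).of_mem ht

theorem eq_one_of_eq_map_inr_mul (hψ : IsGrowingOver L ψ h) (hL : FactorClosed L)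
    (hω : OmegaPowerFree L) {s : G} {v : FreeMonoid B} {x : FreeMonoid (G ⊕ B)}
    (hs : ψ (of (Sum.inl s)) = map Sum.inr v * of (Sum.inl s) * x) : v = 1 := by
  refine hω v fun n => ?_
  obtain ⟨y, hy⟩ := exists_iterate_eq_pow_mul (hψ.map_inr v) hs n
  have hn := hψ.staysIn s n
  rw [hy, ← map_pow, map_mul, hψ.hom_inr] at hn
  exact hL (x := 1) (z := h y) (by rwa [one_mul])

theorem eq_one_of_eq_mul_map_inr (hψ : IsGrowingOver L ψ h) (hL : FactorClosed L)
    (hω : OmegaPowerFree L) {s : G} {v : FreeMonoid B} {x : FreeMonoid (G ⊕ B)}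
    (hs : ψ (of (Sum.inl s)) = x * of (Sum.inl s) * map Sum.inr v) : v = 1 := by
  refine hω v fun n => ?_
  obtain ⟨y, hy⟩ := exists_iterate_eq_mul_pow (hψ.map_inr v) hs n
  have hn := hψ.staysIn s n
  rw [hy, ← map_pow, map_mul, hψ.hom_inr] at hn
  exact hL (x := h y) (z := 1) (by rwa [mul_one])

theorem exists_semiconj_growingPart (hψ : IsGrowingOver L ψ h) :
    ∃ σ : FreeMonoid G →* FreeMonoid G, Semiconj growingPart ψ σ ∧ ∀ s, σ (of s) ≠ 1 := by
  let σ : FreeMonoid G →* FreeMonoid G := lift fun s => growingPart (ψ (of (Sum.inl s)))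
  refine ⟨σ, semiconj_of_forall_of fun c => ?_, fun s hs => ?_⟩
  · rcases c with s | b
    · rfl
    · rw [← map_of, hψ.map_inr, growingPart_map_inr, map_one]
  · obtain ⟨v, hv⟩ := exists_eq_map_inr_of_growingPart_eq_one hs
    exact hψ.not_grows_map_inr v (hv ▸ grows_map_self_iff.2 (hψ.grows s))

theorem exists_iterateHom_eq_mul_mul [Finite G] (hψ : IsGrowingOver L ψ h) :
    ∃ (p : ℕ) (f g : G → G) (v u : G → FreeMonoid B) (m x y : G → FreeMonoid (G ⊕ B)), 1 ≤ p ∧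
      (∀ s, f (f s) = f s) ∧ (∀ s, g (g s) = g s) ∧
      (∀ s, MorphicWords.iterateHom ψ p (of (Sum.inl s)) =
        map Sum.inr (v s) * m s * map Sum.inr (u s)) ∧
      (∀ s, m s = of (Sum.inl (f s)) * x s) ∧ ∀ s, m s = y s * of (Sum.inl (g s)) := by
  obtain ⟨σ, hσ, hne⟩ := hψ.exists_semiconj_growingPart
  choose f hf using fun s => exists_head?_eq_some (hne s)
  choose g hg using fun s => exists_getLast?_eq_some (hne s)
  obtain ⟨p, hp, hidem⟩ := exists_iterate_idempotent (Prod.map f g) id fun _ => Set.toFinite _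
  have hσp : ∀ s, growingPart (ψ^[p] (of (Sum.inl s))) = σ^[p] (of s) := fun s =>
    hσ.iterate_right p (of (Sum.inl s))
  choose v m u x y hm hx hy using fun s => exists_eq_map_inr_mul_mul_map_inr
    ((congrArg (fun w => w.toList.head?) (hσp s)).trans (head?_iterate_of hf p s))
    ((congrArg (fun w => w.toList.getLast?) (hσp s)).trans (getLast?_iterate_of hg p s))
  simp only [Prod.map_iterate, id, Prod.forall, Prod.map_apply, Prod.mk.injEq] at hidem
  exact ⟨p, f^[p], g^[p], v, u, m, x, y, hp, fun s => (hidem s s).1, fun s => (hidem s s).2, hm, hx,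
    hy⟩

theorem exists_conj_bounded_by_inl [Finite G] (hψ : IsGrowingOver L ψ h) (hL : FactorClosed L)
    (hω : OmegaPowerFree L) :
    ∃ (ψ' : FreeMonoid (G ⊕ B) →* FreeMonoid (G ⊕ B)) (h' : FreeMonoid (G ⊕ B) →* FreeMonoid B),
      IsGrowingOver L ψ' h' ∧ (∀ s, ∃ t x, ψ' (of (Sum.inl s)) = of (Sum.inl t) * x) ∧
      ∀ s, ∃ t y, ψ' (of (Sum.inl s)) = y * of (Sum.inl t) := by
  obtain ⟨p, f, g, v, u, m, x, y, hp, hf, hg, hm, hx, hy⟩ := hψ.exists_iterateHom_eq_mul_mul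
  replace hψ := hψ.iterateHom hp
  have hv : ∀ s, v (f s) = 1 := fun s =>
    hψ.eq_one_of_eq_map_inr_mul hL hω (s := f s) (x := x (f s) * map Sum.inr (u (f s))) (by
      rw [hm, hx, hf]
      simp only [mul_assoc])
  have hu : ∀ s, u (g s) = 1 := fun s =>
    hψ.eq_one_of_eq_mul_map_inr hL hω (s := g s) (x := map Sum.inr (v (g s)) * y (g s)) (by
      rw [hm, hy, hg]
      simp only [mul_assoc])
  refine ⟨_, _, hψ.conj_sumLift hL hm fun s => ⟨f s, ?_⟩, fun s => ⟨f s, ?_⟩, fun s => ⟨g s, ?_⟩⟩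
  · rw [hx]
    exact mem_mul.2 (Or.inl mem_of_self)
  · rw [MonoidHom.comp_apply, sumLift_inl, hx, map_mul, sumLift_inl, hv, map_one, one_mul,
      mul_assoc]
    exact ⟨_, rfl⟩
  · rw [MonoidHom.comp_apply, sumLift_inl, hy, map_mul, sumLift_inl, hu, map_one, mul_one,
      ← mul_assoc]
    exact ⟨_, rfl⟩

end IsGrowingOver

end Trimming

section Blocks

variable {G B : Type*}

/-- The morphism reading a letter `(s, v)` as the growing letter `s` followed by the constants
`v`. -/
def spell : FreeMonoid (G × FreeMonoid B) →* FreeMonoid (G ⊕ B) :=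
  lift fun q => of (Sum.inl q.1) * map Sum.inr q.2

theorem spell_of (s : G) (v : FreeMonoid B) :
    spell (of (s, v)) = of (Sum.inl s) * map Sum.inr v := rfl

theorem exists_eq_map_inr_mul_spell (w : FreeMonoid (G ⊕ B)) :
    ∃ v r, w = map Sum.inr v * spell r := by
  induction w using FreeMonoid.inductionOn' with
  | one => exact ⟨1, 1, rfl⟩
  | of_mul c w ih =>
    obtain ⟨v, r, rfl⟩ := ih
    rcases c with s | b
    · exact ⟨1, of (s, v) * r, by rw [map_one, one_mul, map_mul, spell_of, mul_assoc]⟩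
    · exact ⟨of b * v, r, by rw [map_mul, map_of, mul_assoc]⟩

theorem exists_eq_spell_mul_of_inl {w x y : FreeMonoid (G ⊕ B)} {s t : G}
    (hx : w = of (Sum.inl s) * x) (hy : w = y * of (Sum.inl t)) :
    ∃ r, w = spell r * of (Sum.inl t) := by
  obtain ⟨v, r, rfl⟩ := exists_eq_map_inr_mul_spell y
  cases v with
  | one => exact ⟨r, by rw [hy, map_one, one_mul]⟩
  | of_mul b v => nomatch (List.cons.inj (hx.symm.trans hy)).1

variable {L : Set (FreeMonoid B)} {ψ : FreeMonoid (G ⊕ B) →* FreeMonoid (G ⊕ B)}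
  {h : FreeMonoid (G ⊕ B) →* FreeMonoid B}

theorem IsGrowingOver.hasPrimitiveGenerator_of_bounded_by_inl [Finite G] [Nonempty G]
    (hψ : IsGrowingOver L ψ h) (hL : FactorClosed L)
    (hfirst : ∀ s, ∃ t x, ψ (of (Sum.inl s)) = of (Sum.inl t) * x)
    (hlast : ∀ s, ∃ t y, ψ (of (Sum.inl s)) = y * of (Sum.inl t)) : HasPrimitiveGenerator L := by
  choose t x hx using hfirst
  choose g y hy using hlast
  choose r hr using fun s => exists_eq_spell_mul_of_inl (hx s) (hy s)
  let ρ : FreeMonoid (G × FreeMonoid B) →* FreeMonoid (G × FreeMonoid B) :=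
    lift fun q => r q.1 * of (g q.1, q.2)
  have hsemi : Semiconj spell ρ ψ := semiconj_of_forall_of fun q => by
    rw [lift_eval_of, map_mul, spell_of, ← mul_assoc, ← hr, spell_of, map_mul, hψ.map_inr]
  let T : Set (FreeMonoid B) := insert 1 (⋃ s, Prod.snd '' {q | q ∈ r s})
  let E : Set (G × FreeMonoid B) := {q | q.2 ∈ T ∧ StaysIn L ρ (h.comp spell) (of q)}
  have hT : T.Finite :=
    (Set.finite_iUnion fun s => (List.finite_toSet (r s).toList).image _).insert 1
  obtain ⟨s⟩ := ‹Nonempty G›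
  refine hasPrimitiveGenerator_of_finite_set (φ := ρ) (h := h.comp spell) (E := E) ?_ ⟨(s, 1), ?_⟩
    (fun q hq q' hq' => ⟨?_, hq.2.map_self.of_mem hL hq'⟩) (fun q hq => hq.2) fun q _ => ?_
  · exact (Set.finite_univ.prod hT).subset fun q hq => ⟨Set.mem_univ _, hq.1⟩
  · refine ⟨Set.mem_insert _ _, (staysIn_map_iff hsemi).1 ?_⟩
    rw [spell_of, map_one, mul_one]
    exact hψ.staysIn s
  · rcases mem_mul.1 hq' with hq' | hq'
    · exact Or.inr (Set.mem_iUnion.2 ⟨q.1, q', hq', rfl⟩)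
    · exact mem_of.1 hq' ▸ hq.1
  · exact (grows_map_iff hsemi).1 ((hψ.grows q.1).of_mem (mem_mul.2 (Or.inl mem_of_self)))

theorem hasPrimitiveGenerator_of_grows_of_omegaPowerFree {A : Type*} [Finite A]
    {φ : FreeMonoid A →* FreeMonoid A} {h : FreeMonoid A →* FreeMonoid B} (hL : FactorClosed L)
    (hω : OmegaPowerFree L) {a : A} (hs : ∀ c, StaysIn L φ h (of c)) (ha : Grows φ h (of a)) :
    HasPrimitiveGenerator L := by
  obtain ⟨p, q, hp, hφ⟩ := exists_iterateHom_grows_or_fixed φ h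
  obtain ⟨ψ, k, hψ⟩ := exists_isGrowingOver (fun c => (hs c).iterateHom_comp p q) hφ
  obtain ⟨ψ', k', hψ', hfirst, hlast⟩ := hψ.exists_conj_bounded_by_inl hL hω
  have : Nonempty {c // Grows (iterateHom φ p) (h.comp (iterateHom φ q)) (of c)} :=
    ⟨⟨a, ha.iterateHom_comp hp q⟩⟩
  exact hψ'.hasPrimitiveGenerator_of_bounded_by_inl hL hfirst hlast

theorem hasPrimitiveGenerator_of_grows {A : Type*} [Finite A] {φ : FreeMonoid A →* FreeMonoid A}
    {h : FreeMonoid A →* FreeMonoid B} (hL : FactorClosed L) {a : A} (hs : StaysIn L φ h (of a))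
    (ha : Grows φ h (of a)) : HasPrimitiveGenerator L := by
  by_cases hω : OmegaPowerFree L
  · let E : Set A := {c | StaysIn L φ h (of c)}
    obtain ⟨σ, hσ⟩ := exists_hom_semiconj_map (φ := φ) (i := ((↑) : E → A)) fun c d hd =>
      ⟨⟨d, c.2.map_self.of_mem hL hd⟩, rfl⟩
    have hsσ : ∀ c : E, StaysIn L σ (h.comp (map (↑))) (of c) := fun c =>
      (staysIn_map_iff hσ).1 c.2
    have haσ : Grows σ (h.comp (map (↑))) (of (⟨a, hs⟩ : E)) := (grows_map_iff hσ).1 ha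
    exact hasPrimitiveGenerator_of_grows_of_omegaPowerFree hL hω hsσ haσ
  · simp only [OmegaPowerFree, not_forall] at hω
    obtain ⟨v, hvL, hv⟩ := hω
    exact hasPrimitiveGenerator_of_pow_mem hv hvL

end Blocks

section InfiniteWords

variable {A B : Type*}

theorem length_block (X : ℕ → A) (i n : ℕ) : (block X i n).length = n := by
  rw [block, List.length_map, List.length_range]

theorem block_add (X : ℕ → A) (i m n : ℕ) :
    block X i (m + n) = block X i m ++ block X (i + m) n := by
  simp [block, List.range_add, add_assoc]

theorem ofList_block_mem_factors (X : ℕ → A) (i n : ℕ) : ofList (block X i n) ∈ factors X :=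
  ⟨i, n, rfl⟩

theorem eq_block_of_append {X : ℕ → A} {i n : ℕ} {x y : List A} (hxy : x ++ y = block X i n) :
    x = block X i x.length ∧ y = block X (i + x.length) y.length := by
  have hn := congrArg List.length hxy
  rw [List.length_append, length_block] at hn
  rw [← hn, block_add] at hxy
  exact List.append_inj hxy (length_block ..).symm

theorem factorClosed_factors (X : ℕ → A) : FactorClosed (factors X) := by
  rintro x y z ⟨i, n, hxyz⟩
  have hxy := (eq_block_of_append (x := (x * y).toList) (y := z.toList) hxyz).1
  exact ⟨_, _, (eq_block_of_append (x := x.toList) (y := y.toList) hxy).2⟩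

theorem partialConcat_succ (w : ℕ → FreeMonoid A) (n : ℕ) :
    partialConcat w (n + 1) = partialConcat w n * w n := by
  simp [partialConcat, List.range_succ]

theorem partialConcat_isPrefix (w : ℕ → FreeMonoid A) {i j : ℕ} (hij : i ≤ j) :
    (partialConcat w i).toList <+: (partialConcat w j).toList := by
  induction j, hij using Nat.le_induction with
  | base => exact List.prefix_rfl
  | succ j _ ih =>
    rw [partialConcat_succ, toList_mul]
    exact ih.trans (List.prefix_append _ _)

theorem IsConcat.tendsto_length {w : ℕ → FreeMonoid A} {X : ℕ → A} (hX : IsConcat w X) :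
    Tendsto (fun n => (partialConcat w n).length) atTop atTop :=
  Filter.tendsto_atTop_atTop_of_monotone (fun _ _ hij => (partialConcat_isPrefix w hij).length_le)
    hX.2

theorem exists_isConcat {w : ℕ → FreeMonoid A}
    (hw : Tendsto (fun n => (partialConcat w n).length) atTop atTop) : ∃ X, IsConcat w X := by
  have hunbounded : ∀ N, ∃ n, N ≤ (partialConcat w n).length := fun N =>
    (hw.eventually_ge_atTop N).exists
  choose m hm using fun N => hunbounded (N + 1)
  refine ⟨fun N => (partialConcat w (m N)).toList[N]'(hm N), fun n => ?_, hunbounded⟩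
  refine List.ext_getElem (by rw [length_block]) fun j hj _ => ?_
  simp only [block, List.getElem_map, List.getElem_range, Nat.zero_add]
  rcases le_total n (m j) with hn | hn
  · exact (partialConcat_isPrefix w hn).getElem hj
  · exact ((partialConcat_isPrefix w hn).getElem (hm j)).symm

theorem partialConcat_hom (f : FreeMonoid A →* FreeMonoid B) (X : ℕ → A) (n : ℕ) :
    partialConcat (fun i => f (of (X i))) n = f (ofList (block X 0 n)) := by
  induction n with
  | zero => exact (map_one f).symm
  | succ n ih =>
    rw [partialConcat_succ, ih, block_add, ofList_append, map_mul]
    simp [block]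

theorem partialConcat_iterate {φ : FreeMonoid A →* FreeMonoid A} {a : A} {u : FreeMonoid A}
    (hu : φ (of a) = of a * u) (n : ℕ) :
    partialConcat (fun i => Nat.casesOn i (of a) fun k => φ^[k] u) (n + 1) = φ^[n] (of a) := by
  induction n with
  | zero => exact mul_one _
  | succ n ih => rw [partialConcat_succ, ih, iterate_succ_apply, hu, iterate_map_mul]

variable {φ : FreeMonoid A →* FreeMonoid A} {h : FreeMonoid A →* FreeMonoid B} {a : A} {X : ℕ → A}
  {W : ℕ → B}

theorem IsPureMorphic.iterate_eq_block (hX : IsPureMorphic φ a X) (n : ℕ) :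
    φ^[n] (of a) = ofList (block X 0 (φ^[n] (of a)).length) := by
  obtain ⟨u, hu, -, hconcat⟩ := hX
  rw [← partialConcat_iterate hu]
  exact hconcat.1 _

theorem IsPureMorphic.tendsto_length_iterate (hX : IsPureMorphic φ a X) :
    Tendsto (fun n => (φ^[n] (of a)).length) atTop atTop := by
  obtain ⟨u, hu, -, hconcat⟩ := hX
  simpa only [comp_def, partialConcat_iterate hu]
    using hconcat.tendsto_length.comp (Filter.tendsto_add_atTop_nat 1)

theorem IsImage.hom_block (hW : IsImage h X W) (n : ℕ) :
    h (ofList (block X 0 n)) = ofList (block W 0 (h (ofList (block X 0 n))).length) := by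
  rw [← partialConcat_hom]
  exact hW.1 n

theorem IsImage.tendsto_length_hom_block (hW : IsImage h X W) :
    Tendsto (fun n => (h (ofList (block X 0 n))).length) atTop atTop := by
  simpa only [partialConcat_hom] using hW.tendsto_length

theorem IsImage.hom_iterate_eq_block (hX : IsPureMorphic φ a X) (hW : IsImage h X W) (n : ℕ) :
    h (φ^[n] (of a)) = ofList (block W 0 (h (φ^[n] (of a))).length) := by
  rw [hX.iterate_eq_block]
  exact hW.hom_block _

theorem staysIn_factors (hX : IsPureMorphic φ a X) (hW : IsImage h X W) :
    StaysIn (factors W) φ h (of a) := fun n => by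
  rw [hW.hom_iterate_eq_block hX]
  exact ofList_block_mem_factors _ _ _

theorem grows_of_isImage (hX : IsPureMorphic φ a X) (hW : IsImage h X W) : Grows φ h (of a) :=
  (hW.tendsto_length_hom_block.comp hX.tendsto_length_iterate).congr fun n => by
    rw [comp_apply, ← hX.iterate_eq_block]

theorem Grows.iterate_ne_one {u : FreeMonoid A} (hg : Grows φ h (of a))
    (hu : φ (of a) = of a * u) (k : ℕ) : φ^[k] u ≠ 1 := fun hk => by
  have hfixed : φ (φ^[k] (of a)) = φ^[k] (of a) := by
    rw [← iterate_succ_apply' (f := φ), iterate_succ_apply, hu, iterate_map_mul, hk, mul_one]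
  have hconst : ∀ n, φ^[n + k] (of a) = φ^[k] (of a) := fun n => by
    rw [iterate_add_apply, iterate_fixed hfixed]
  obtain ⟨n, hn⟩ := (((Filter.tendsto_add_atTop_iff_nat k).2 hg).eventually_gt_atTop
    (h (φ^[k] (of a))).length).exists
  rw [hconst] at hn
  exact hn.false

theorem tendsto_length_iterate_of_iterate_ne_one {u : FreeMonoid A} (hu : φ (of a) = of a * u)
    (hne : ∀ k, φ^[k] u ≠ 1) : Tendsto (fun n => (φ^[n] (of a)).length) atTop atTop := by
  refine StrictMono.tendsto_atTop (strictMono_nat_of_lt_succ fun n => ?_)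
  have hpos : (φ^[n] u).length ≠ 0 := mt length_eq_zero.1 (hne n)
  rw [iterate_succ_apply, hu, iterate_map_mul, length_mul]
  omega

theorem exists_isPureMorphic {u : FreeMonoid A} (hu : φ (of a) = of a * u)
    (hne : ∀ k, φ^[k] u ≠ 1) : ∃ X, IsPureMorphic φ a X := by
  obtain ⟨X, hX⟩ := exists_isConcat (w := fun i => Nat.casesOn i (of a) fun k => φ^[k] u) <|
    (Filter.tendsto_add_atTop_iff_nat 1).1 <| by
      simpa only [partialConcat_iterate hu] using tendsto_length_iterate_of_iterate_ne_one hu hne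
  exact ⟨X, u, hu, hne, hX⟩

theorem exists_isImage (hX : IsPureMorphic φ a X) (hg : Grows φ h (of a)) :
    ∃ W, IsImage h X W := by
  refine exists_isConcat (Filter.tendsto_atTop_atTop_of_monotone
    (fun _ _ hij => (partialConcat_isPrefix _ hij).length_le) fun N => ?_)
  obtain ⟨n, hn⟩ := (hg.eventually_ge_atTop N).exists
  rw [hX.iterate_eq_block] at hn
  exact ⟨_, by rwa [partialConcat_hom]⟩

theorem factors_subset_of_staysIn {L : Set (FreeMonoid B)} (hL : FactorClosed L)
    (hX : IsPureMorphic φ a X) (hW : IsImage h X W) (hs : StaysIn L φ h (of a)) :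
    factors W ⊆ L := by
  rintro v ⟨i, n, hv⟩
  obtain ⟨m, hm⟩ := ((grows_of_isImage hX hW).eventually_ge_atTop (i + n)).exists
  obtain ⟨r, hr⟩ := Nat.exists_eq_add_of_le hm
  have hmem := hs m
  rw [hW.hom_iterate_eq_block hX, hr, block_add, block_add, ofList_append, ofList_append, zero_add,
    ← hv] at hmem
  exact hL hmem

theorem UniformlyRecurrent.factors_eq_of_subset {V : ℕ → B} (hW : UniformlyRecurrent W)
    (hVW : factors V ⊆ factors W) : factors V = factors W := by
  refine hVW.antisymm fun v hv => ?_
  obtain ⟨k, hk⟩ := hW v hv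
  have hblock := ofList_block_mem_factors V 0 k
  obtain ⟨x, y, hxy⟩ := hk _ (hVW hblock) (length_block V 0 k).ge
  exact factorClosed_factors V (x := ofList x) (z := ofList y) ⟨0, k, hxy⟩

end InfiniteWords

end MorphicWords

open MorphicWords in
theorem mainTheorem5_general {A B : Type*} [Finite A]
    (φ : FreeMonoid A →* FreeMonoid A) (h : FreeMonoid A →* FreeMonoid B) (a : A)
    (X : ℕ → A) (hX : IsPureMorphic φ a X) (W : ℕ → B) (hW : IsImage h X W)
    (hrec : UniformlyRecurrent W) :
    ∃ (D : Type) (_ : Finite D) (ρ : FreeMonoid D →* FreeMonoid D)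
      (g : FreeMonoid D →* FreeMonoid B) (d : D) (Y : ℕ → D) (V : ℕ → B),
      IsPrimitive ρ ∧ IsPureMorphic ρ d Y ∧ IsImage g Y V ∧ factors V = factors W := by
  have hL := factorClosed_factors W
  obtain ⟨D, hD, ρ, g, d, u, hρ, hu, hs, hg⟩ :=
    hasPrimitiveGenerator_of_grows hL (staysIn_factors hX hW) (grows_of_isImage hX hW)
  obtain ⟨Y, hY⟩ := exists_isPureMorphic hu (hg.iterate_ne_one hu)
  obtain ⟨V, hV⟩ := exists_isImage hY hg
  exact ⟨D, hD, ρ, g, d, Y, V, hρ, hY, hV,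
    hrec.factors_eq_of_subset (factors_subset_of_staysIn hL hY hV hs)⟩

theorem mainTheorem5 {A B : Type*} [Finite A] [Finite B]
    (φ : FreeMonoid A →* FreeMonoid A) (h : FreeMonoid A →* FreeMonoid B) (a : A)
    (X : ℕ → A) (hX : MorphicWords.IsPureMorphic φ a X)
    (W : ℕ → B) (hW : MorphicWords.IsImage h X W)
    (hper : ¬ MorphicWords.IsPeriodic W) (hrec : MorphicWords.UniformlyRecurrent W) :
    ∃ (D : Type) (_ : Finite D) (ρ : FreeMonoid D →* FreeMonoid D)
      (g : FreeMonoid D →* FreeMonoid B) (d : D) (Y : ℕ → D) (V : ℕ → B),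
      MorphicWords.IsPrimitive ρ ∧ MorphicWords.IsPureMorphic ρ d Y ∧
        MorphicWords.IsImage g Y V ∧
        MorphicWords.factors V = MorphicWords.factors W :=
  mainTheorem5_general φ h a X hX W hW hrec
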